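/- Let $\mathbb K$ be a field of characteristic zero, $V=\mathbb K^{\ell+1}$, $S=\mathbb K[x_0,\dots,x_\ell]$, and let $\alpha_1,\dots,\alpha_n\in V^*$ be nonzero linear forms defining $n$ distinct hyperplanes $H_j=\mathbb V(\alpha_j)$ of $\mathbb P(V)=\mathbb P^\ell$; write $\mathcal A=\mathcal A(\alpha)$ for this arrangement, $\mathcal M(\alpha)$ for the linear matroid of $\alpha_1,\dots,\alpha_n$ on $\{1,\dots,n\}$ and $\operatorname{rank}(\mathcal A)=\dim\langle\alpha_1,\dots,\alpha_n\rangle$. Let $k$ be an integer with $2\le k$ and $k+1\le\operatorname{rank}(\mathcal A)$. *Jacobian side.* Let $Q=\prod_j\alpha_j\in S$, let $J_{\mathcal A}=\langle\partial Q/\partial x_0,\dots,\partial Q/\partial x_\ell\rangle$, and let $J^{[k]}_{\mathcal A}$ be the intersection of all primary components of $J_{\mathcal A}$ whose associated prime has height at most $k$. *Perspective representations.* A hyperplane $H_0=\mathbb V(\alpha_0)$ is in rank $m$ general linear position with respect to $\mathcal A$ if it contains no nonempty flat $\bigcap_{j\in X}H_j\subseteq\mathbb P^\ell$ with $X$ a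 flat of $\mathcal M(\alpha)$ of rank at most $m$. For such $H_0$, a map $\beta:\{1,\dots,n\}\to V^*$ is a weak perspective representation of $\mathcal A$ from $H_0$ up to rank $m$ if the $\beta_j$ define $n$ distinct hyperplanes $H'_j$; $H_0$ is none of the $H_j,H'_j$; $H_j\cap H_0=H'_j\cap H_0$ for all $j$; and every set of labels that is dependent in the truncation $\mathcal M(\alpha)^{[m]}$ is dependent in $\mathcal M(\beta)^{[m]}$ (a set is independent in $\mathcal M^{[m]}$ if it is independent in $\mathcal M$ and has at most $m$ elements). For $H_0$ in rank $2$ general linear position, $\beta$ is trivial from $H_0$ if either, up to rescaling each form, $\beta_j=\alpha_j\circ T^{-1}$ for all $j$, where $T$ is a linear automorphism of $V$ inducing the identity on $H_0$, or there is a point $q\in\mathbb P^\ell\setminus H_0$ such that each $\beta_j$ defines the hyperplane through $q$ and $\mathbb V(\alpha_j,\alpha_0)$. Normalizing $\beta_j=\alpha_j+\lambda_j\alpha_0$, let $W_{H_0}\subseteq\mathbb K^n$ be the set of $\lambda$ for which $\beta$ is a weak perspective representation from $H_0$ up to rank $k+1$, and $T_{H_0}\subseteq\mathbb K^n$ the set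 of $\lambda$ for which $\beta$ is trivial from $H_0$. *Claim.* Hyperplanes in rank $k+1$ general linear position with respect to $\mathcal A$ exist, and for every such hyperplane $H_0=\mathbb V(\alpha_0)$ the sets $T_{H_0}\subseteq W_{H_0}$ are linear subspaces of $\mathbb K^n$, and the degree $n-1$ part of $J^{[k]}_{\mathcal A}/J_{\mathcal A}$ is isomorphic, as a $\mathbb K$-vector space, to the space $W_{H_0}/T_{H_0}$ of non-trivial weak perspective representations of $\mathcal A$ up to rank $k+1$: $$\bigl(J^{[k]}_{\mathcal A}/J_{\mathcal A}\bigr)_{n-1}\;\cong\;W_{H_0}/T_{H_0}.$$ -/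

import Mathlib

namespace HypArr

variable {K : Type*} [Field K] {ℓ n : ℕ}

/-- The dual `V^*` of `V = K^(ℓ+1)`, i.e. the linear forms on `V`. -/
abbrev Form (K : Type*) [Field K] (ℓ : ℕ) : Type _ := Module.Dual K (Fin (ℓ + 1) → K)

/-! ### Arrangements and their matroids -/

/-- `α` defines an arrangement of `n` distinct hyperplanes `V(α_j)` in `P(V)`. -/
def IsArrangement (α : Fin n → Form K ℓ) : Prop :=
  (∀ j, α j ≠ 0) ∧ ∀ i j, i ≠ j → LinearMap.ker (α i) ≠ LinearMap.ker (α j)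

/-- The rank, in the linear matroid `M(α)`, of a set of labels. -/
noncomputable def rankOn (α : Fin n → Form K ℓ) (X : Set (Fin n)) : ℕ :=
  Module.finrank K (Submodule.span K (α '' X))

/-- The rank of the arrangement (that is, of `M(α)`). -/
noncomputable def rank (α : Fin n → Form K ℓ) : ℕ := rankOn α Set.univ

/-- The flats (closed sets) of `M(α)`. -/
def IsFlat (α : Fin n → Form K ℓ) (X : Set (Fin n)) : Prop :=
  ∀ j, α j ∈ Submodule.span K (α '' X) → j ∈ X

/-- The linear subspace of `V` on which all the forms labelled by `X` vanish; its
projectivization is the flat of the arrangement that corresponds to `X`. -/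
def zeroLocus (α : Fin n → Form K ℓ) (X : Set (Fin n)) : Submodule K (Fin (ℓ + 1) → K) :=
  ⨅ j ∈ X, LinearMap.ker (α j)

/-- The independent sets of the rank `k` truncation `M(α)^[k]`. -/
def TruncIndep (α : Fin n → Form K ℓ) (k : ℕ) (I : Finset (Fin n)) : Prop :=
  I.card ≤ k ∧ LinearIndepOn K α (I : Set (Fin n))

/-- `β` is a weak representation of `M(α)` up to rank `k`: `M(α)^[k] ≥ M(β)^[k]` in the weak
order, i.e. every dependent set of `M(α)^[k]` is dependent in `M(β)^[k]`. -/
def IsWeakRep (α : Fin n → Form K ℓ) (k : ℕ) (β : Fin n → Form K ℓ) : Prop :=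
  ∀ D : Finset (Fin n), ¬ TruncIndep α k D → ¬ TruncIndep β k D

/-! ### Weak perspective representations -/

/-- The hyperplane `H₀ = V(α₀)` is in rank `k` general linear position with respect to `A(α)`: no
(nonempty) flat `P(zeroLocus α X)` of rank at most `k` is contained in `H₀`. When `M(α)` has
rank `ℓ + 1`, its top flat is empty in `P(V)` and imposes no condition. -/
def InGeneralPosition (α : Fin n → Form K ℓ) (k : ℕ) (α₀ : Form K ℓ) : Prop :=
  α₀ ≠ 0 ∧ ∀ X : Set (Fin n), IsFlat α X → rankOn α X ≤ k → zeroLocus α X ≠ ⊥ →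
    ¬ zeroLocus α X ≤ LinearMap.ker α₀

/-- `A(α)` and `A(β)` are perspective from `H₀ = V(α₀)`: `H₀` is in neither arrangement and
`H_j ∩ H₀ = H'_j ∩ H₀` for all `j`. -/
def ArePerspective (α β : Fin n → Form K ℓ) (α₀ : Form K ℓ) : Prop :=
  α₀ ≠ 0 ∧
  (∀ j, LinearMap.ker (α j) ≠ LinearMap.ker α₀) ∧
  (∀ j, LinearMap.ker (β j) ≠ LinearMap.ker α₀) ∧
  ∀ j, LinearMap.ker (α j) ⊓ LinearMap.ker α₀ = LinearMap.ker (β j) ⊓ LinearMap.ker α₀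

/-- `β` is a weak perspective representation of `A(α)` from `H₀ = V(α₀)` up to rank `k`. -/
def IsWeakPRep (α : Fin n → Form K ℓ) (α₀ : Form K ℓ) (k : ℕ) (β : Fin n → Form K ℓ) : Prop :=
  InGeneralPosition α k α₀ ∧ IsArrangement β ∧ ArePerspective α β α₀ ∧ IsWeakRep α k β

/-- `β` is a trivial weak perspective representation of `A(α)` from `H₀ = V(α₀)`: either `β` is
`α ∘ T⁻¹` (as an arrangement, i.e. up to rescaling each form) for a linear automorphism `T` of `V`
that induces the identity on `H₀ ⊆ P(V)`, or there is a point `q ∉ H₀` such that every `β_j`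
defines the hyperplane through `q` and `V(α_j, α₀)`. -/
def IsTrivialWeakPRep (α : Fin n → Form K ℓ) (α₀ : Form K ℓ) (β : Fin n → Form K ℓ) : Prop :=
  InGeneralPosition α 2 α₀ ∧
  ((∃ T : (Fin (ℓ + 1) → K) ≃ₗ[K] (Fin (ℓ + 1) → K),
      (∀ x ∈ LinearMap.ker α₀, ∃ c : K, T x = c • x) ∧
      ∀ j, ∃ c : K, c ≠ 0 ∧ β j = c • (α j ∘ₗ T.symm.toLinearMap)) ∨
   (∃ q : Fin (ℓ + 1) → K, α₀ q ≠ 0 ∧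
      ∀ j, β j ≠ 0 ∧ β j q = 0 ∧
        LinearMap.ker (α j) ⊓ LinearMap.ker α₀ ≤ LinearMap.ker (β j)))

/-- The forms `β_j = α_j + t_j α₀`. -/
def shift (α : Fin n → Form K ℓ) (α₀ : Form K ℓ) (t : Fin n → K) : Fin n → Form K ℓ :=
  fun j => α j + t j • α₀

/-- The weak perspective representations of `A(α)` from `H₀ = V(α₀)` up to rank `k`, in the
coordinates `t ∈ K^n` given by the normalization `β_j = α_j + t_j α₀`. -/
def weakPReps (α : Fin n → Form K ℓ) (α₀ : Form K ℓ) (k : ℕ) : Set (Fin n → K) :=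
  {t | IsWeakPRep α α₀ k (shift α α₀ t)}

/-- The trivial weak perspective representations of `A(α)` from `H₀ = V(α₀)`, in the same
coordinates. -/
def trivialWeakPReps (α : Fin n → Form K ℓ) (α₀ : Form K ℓ) : Set (Fin n → K) :=
  {t | IsTrivialWeakPRep α α₀ (shift α α₀ t)}

/-! ### The Jacobian ideal and its saturations -/

/-- A linear form as a polynomial in the coordinates `x_0, …, x_ℓ`. -/
noncomputable def toPoly (φ : Form K ℓ) : MvPolynomial (Fin (ℓ + 1)) K :=
  ∑ i, MvPolynomial.C (φ (Pi.single i 1)) * MvPolynomial.X i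

/-- The defining polynomial `Q(A) = ∏ α_j`. -/
noncomputable def definingPoly (α : Fin n → Form K ℓ) : MvPolynomial (Fin (ℓ + 1)) K :=
  ∏ j, toPoly (α j)

/-- The Jacobian ideal `J_A`, generated by the partial derivatives of `Q(A)`. -/
noncomputable def jacobianIdeal (α : Fin n → Form K ℓ) : Ideal (MvPolynomial (Fin (ℓ + 1)) K) :=
  Ideal.span (Set.range fun i => MvPolynomial.pderiv i (definingPoly α))

/-- The intersection of all primary components of `I` (members of minimal primary decompositions
of `I`) whose associated prime has height at most `k`. The intersection of the components of
height at most `k` in one minimal primary decomposition does not depend on the decomposition, so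
ranging over all of them changes nothing. -/
noncomputable def codimSaturation {R : Type*} [CommRing R] (I : Ideal R) (k : ℕ) : Ideal R :=
  sInf {q | ∃ s : Finset (Ideal R), Submodule.IsMinimalPrimaryDecomposition I s ∧ q ∈ s ∧
    q.radical.height ≤ (k : ℕ∞)}

/-- The codimension-`k` saturation `J_A^[k]` of the Jacobian ideal. -/
noncomputable def jacobianSaturation (α : Fin n → Form K ℓ) (k : ℕ) :
    Ideal (MvPolynomial (Fin (ℓ + 1)) K) :=
  codimSaturation (jacobianIdeal α) k

/-- The degree `d` part of `I / J` for homogeneous ideals `J ≤ I` of a polynomial ring: the classes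
of the homogeneous polynomials of degree `d` in `I`. -/
noncomputable def quotientDegreePart {σ : Type*} (I J : Ideal (MvPolynomial σ K)) (d : ℕ) :
    Submodule K (I ⧸ Submodule.submoduleOf J I) :=
  ((MvPolynomial.homogeneousSubmodule σ K d).comap (I.subtype.restrictScalars K)).map
    ((Submodule.mkQ (Submodule.submoduleOf J I)).restrictScalars K)

end HypArr

/-!
Write `P_t = ∑ t_j Q / α_j` for `t ∈ K^n`, and call `t` *locally a vector of values* if on each set
`X` of labels of rank at most `k` it has the form `t_j = α_j(v)`, with `v` depending on `X`. The
map `t ↦ P_t` induces the isomorphism, with `W` the space of these `t` (`locallyEvalForms`) and `T`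
the space of the globally defined vectors of values `(α_j(v))_j` (the range of `evalForms`).

*Polynomial side.* Since `∂Q/∂x_i = ∑ α_j(e_i) Q / α_j`, every `P_t` with `t ∈ T` is in the Jacobian
ideal `J`. Modulo `α_j` all the `Q / α_i` with `i ≠ j` vanish, so a relation
`f P_t = ∑ g_i ∂Q/∂x_i` gives `f t_j = ∑ g_i α_j(e_i)` on `H_j`. At a point where `f ≠ 0` this says
that `t_j = α_j(w)` for one `w` and all `j` with `H_j` through the point
(`exists_eq_of_mul_cofactorSum_mem`). With `f = 1` at the origin it shows that `P_t ∈ J` only for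
`t ∈ T`. An element of `J^[k]` has a multiple `f P ∈ J` with `f` not vanishing identically on the
common zeros of the `α_j`, `j ∈ X`, whenever `X` has rank at most `k`: these linear subspaces
correspond to primes of height equal to the rank of `X`. So `P_t ∈ J^[k]` implies that `t` is
locally a vector of values. Conversely, at a prime of height at most `k` the forms `α_j` that it
contains have rank at most `k`, the other ones are units, and `Q ∈ J` by Euler's formula, so
`P_t` agrees modulo `J` with some `P_s`, `s ∈ T` (`cofactorSum_mem_of_mem_locallyEvalForms`).
Finally, every element of `J^[k]` of degree `n - 1` is some `P_t`: on `H_j` it is divisible by each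
of the linear factors of `Q / α_j`, by the condition at the rank two flat `{i, j}`, and so is a
constant multiple `t_j Q / α_j` there; the difference with `P_t` is then divisible by `Q`, of degree
`n` (`exists_eq_cofactorSum`).

*Matroid side.* General position says that `α₀` is not in the span of the `α_j`, `j ∈ X`, for `X` of
rank at most `k`. Hence a set `X` of labels of such rank has the same dependencies for
`β_j = α_j + t_j α₀` as for the pairs `(α_j, t_j)`, and the dependent sets of `α` with at most
`k + 1` elements remain dependent for `β` exactly if `t` is locally a vector of values
(`isWeakRep_shift_of_mem`, `mem_of_isWeakRep_shift`). The trivial `β` are those of the form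
`α_j ∘ (1 + w ⊗ α₀)`, that is `t_j = α_j(w)`; the endomorphism `1 + w ⊗ α₀` is invertible, or else
it is a projection whose kernel is the point `q = w`.
-/

namespace HypArr

variable {K : Type*} [Field K] {ℓ n : ℕ}

section Polynomials

open MvPolynomial

/-! ### Linear forms as polynomials and linear primes -/

theorem eval_toPoly (φ : Form K ℓ) (v : Fin (ℓ + 1) → K) : eval v (toPoly φ) = φ v := by
  simp only [toPoly, map_sum, map_mul, eval_C, eval_X]
  conv_rhs => rw [pi_eq_sum_univ' v]
  simp [map_sum, mul_comm]

theorem toPoly_add (φ ψ : Form K ℓ) : toPoly (φ + ψ) = toPoly φ + toPoly ψ := by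
  simp [toPoly, add_mul, Finset.sum_add_distrib]

theorem toPoly_smul (c : K) (φ : Form K ℓ) : toPoly (c • φ) = C c * toPoly φ := by
  simp [toPoly, Finset.mul_sum, mul_assoc]

theorem toPoly_zero : toPoly (0 : Form K ℓ) = 0 := by simp [toPoly]

theorem toPoly_proj (i : Fin (ℓ + 1)) : toPoly (LinearMap.proj i : Form K ℓ) = X i := by
  simp [toPoly, Pi.single_apply]

theorem isHomogeneous_toPoly (φ : Form K ℓ) : (toPoly φ).IsHomogeneous 1 :=
  IsHomogeneous.sum _ _ _ fun i _ => by
    simpa using (isHomogeneous_C (Fin (ℓ + 1)) (φ (Pi.single i 1))).mul (isHomogeneous_X K i)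

theorem pderiv_toPoly (i : Fin (ℓ + 1)) (φ : Form K ℓ) :
    pderiv i (toPoly φ) = C (φ (Pi.single i 1)) := by
  simp [toPoly, pderiv_X, Pi.single_apply]

theorem toPoly_eq_zero_iff {φ : Form K ℓ} : toPoly φ = 0 ↔ φ = 0 := by
  refine ⟨fun h => LinearMap.ext fun v => ?_, fun h => h ▸ toPoly_zero⟩
  rw [← eval_toPoly, h]; simp

/-- The substitution `f ↦ f ∘ π` on polynomial functions, for a linear endomorphism `π` of `V`. -/
noncomputable def subst (π : (Fin (ℓ + 1) → K) →ₗ[K] (Fin (ℓ + 1) → K)) :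
    MvPolynomial (Fin (ℓ + 1)) K →ₐ[K] MvPolynomial (Fin (ℓ + 1)) K :=
  aeval fun i => toPoly (LinearMap.proj i ∘ₗ π)

theorem eval_subst (π : (Fin (ℓ + 1) → K) →ₗ[K] (Fin (ℓ + 1) → K))
    (f : MvPolynomial (Fin (ℓ + 1)) K) (v : Fin (ℓ + 1) → K) :
    eval v (subst π f) = eval (π v) f := by
  rw [← coe_aeval_eq_eval, ← coe_aeval_eq_eval]
  change ((aeval v).comp (subst π)) f = aeval (π v) f
  congr 1
  ext i
  simp [subst, aeval_eq_eval, eval_toPoly]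

/-- The ideal generated by the linear forms in a subspace `U ⊆ V^*`. -/
noncomputable def formIdeal (U : Submodule K (Form K ℓ)) : Ideal (MvPolynomial (Fin (ℓ + 1)) K) :=
  Ideal.span (toPoly '' (U : Set (Form K ℓ)))

theorem toPoly_mem_formIdeal {U : Submodule K (Form K ℓ)} {φ : Form K ℓ} (h : φ ∈ U) :
    toPoly φ ∈ formIdeal U :=
  Ideal.subset_span ⟨φ, h, rfl⟩

theorem formIdeal_span_singleton (φ : Form K ℓ) :
    formIdeal (Submodule.span K {φ}) = Ideal.span {toPoly φ} := by
  apply le_antisymm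
  · rw [formIdeal, Ideal.span_le]
    rintro _ ⟨ψ, hψ, rfl⟩
    obtain ⟨c, rfl⟩ := Submodule.mem_span_singleton.1 hψ
    rw [toPoly_smul]
    exact Ideal.mul_mem_left _ _ (Ideal.subset_span rfl)
  · rw [Ideal.span_le, Set.singleton_subset_iff]
    exact toPoly_mem_formIdeal (Submodule.mem_span_singleton_self φ)

/-- Every subspace is the image of a linear endomorphism that fixes it pointwise. -/
theorem exists_retraction (Z : Submodule K (Fin (ℓ + 1) → K)) :
    ∃ π : (Fin (ℓ + 1) → K) →ₗ[K] (Fin (ℓ + 1) → K), (∀ v, π v ∈ Z) ∧ ∀ v ∈ Z, π v = v := by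
  obtain ⟨g, hg⟩ := Z.subtype.exists_leftInverse_of_injective (by simp)
  refine ⟨Z.subtype ∘ₗ g, fun v => (g v).2, fun v hv => ?_⟩
  simpa using congrArg Subtype.val (LinearMap.congr_fun hg ⟨v, hv⟩)

section Infinite

variable [Infinite K]

theorem subst_toPoly (π : (Fin (ℓ + 1) → K) →ₗ[K] (Fin (ℓ + 1) → K)) (φ : Form K ℓ) :
    subst π (toPoly φ) = toPoly (φ ∘ₗ π) :=
  MvPolynomial.funext fun v => by simp [eval_subst, eval_toPoly]

/-- The ideal generated by the forms in `U` is the full vanishing ideal of the linear subspace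
that they cut out: modulo it, `f` agrees with `f ∘ π` for a projection `π` onto this subspace. -/
theorem mem_formIdeal_iff {U : Submodule K (Form K ℓ)} {f : MvPolynomial (Fin (ℓ + 1)) K} :
    f ∈ formIdeal U ↔ ∀ v ∈ U.dualCoannihilator, eval v f = 0 := by
  constructor
  · intro hf v hv
    have : formIdeal U ≤ RingHom.ker (eval v) := by
      rw [formIdeal, Ideal.span_le]
      rintro _ ⟨φ, hφ, rfl⟩
      simpa [RingHom.mem_ker, eval_toPoly] using (Submodule.mem_dualCoannihilator v).1 hv φ hφ
    exact this hf
  · intro hf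
    obtain ⟨π, hπ, hπ'⟩ := exists_retraction U.dualCoannihilator
    have h0 : subst π f = 0 := MvPolynomial.funext fun v => by
      rw [eval_subst, hf _ (hπ v), map_zero]
    have key : (Ideal.Quotient.mkₐ K (formIdeal U)).comp (subst π)
        = Ideal.Quotient.mkₐ K (formIdeal U) := by
      ext i
      rw [AlgHom.comp_apply, Ideal.Quotient.mkₐ_eq_mk, Ideal.Quotient.eq, subst, aeval_X,
        ← toPoly_proj i, sub_eq_add_neg, ← neg_one_mul, ← C_1, ← C_neg, ← toPoly_smul,
        ← toPoly_add]
      apply toPoly_mem_formIdeal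
      rw [← Subspace.dualCoannihilator_dualAnnihilator_eq (W := U), Submodule.mem_dualAnnihilator]
      intro v hv
      simp [hπ' v hv]
    have := DFunLike.congr_fun key f
    rw [AlgHom.comp_apply, h0, map_zero] at this
    exact Ideal.Quotient.eq_zero_iff_mem.1 this.symm

theorem formIdeal_isPrime (U : Submodule K (Form K ℓ)) : (formIdeal U).IsPrime := by
  obtain ⟨π, hπ, hπ'⟩ := exists_retraction U.dualCoannihilator
  have key : formIdeal U = RingHom.ker (subst π) := by
    ext f
    rw [mem_formIdeal_iff, RingHom.mem_ker]
    refine ⟨fun h => MvPolynomial.funext fun v => ?_, fun h v hv => ?_⟩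
    · rw [eval_subst, h _ (hπ v), map_zero]
    · rw [← hπ' v hv, ← eval_subst, h, map_zero]
  rw [key]
  exact RingHom.ker_isPrime _

theorem mem_of_toPoly_mem_formIdeal {U : Submodule K (Form K ℓ)} {φ : Form K ℓ}
    (h : toPoly φ ∈ formIdeal U) : φ ∈ U := by
  rw [← Subspace.dualCoannihilator_dualAnnihilator_eq (W := U), Submodule.mem_dualAnnihilator]
  intro v hv
  rw [← eval_toPoly]
  exact mem_formIdeal_iff.1 h v hv

theorem toPoly_dvd_iff {φ : Form K ℓ} {f : MvPolynomial (Fin (ℓ + 1)) K} :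
    toPoly φ ∣ f ↔ ∀ v, φ v = 0 → eval v f = 0 := by
  rw [← Ideal.mem_span_singleton, ← formIdeal_span_singleton, mem_formIdeal_iff]
  refine forall_congr' fun v => imp_congr_left ?_
  rw [Submodule.mem_dualCoannihilator]
  refine ⟨fun h => h φ (Submodule.mem_span_singleton_self φ), fun h ψ hψ => ?_⟩
  obtain ⟨c, rfl⟩ := Submodule.mem_span_singleton.1 hψ
  simp [h]

theorem prime_toPoly {φ : Form K ℓ} (h : φ ≠ 0) : Prime (toPoly φ) := by
  rw [← Ideal.span_singleton_prime (toPoly_eq_zero_iff.not.2 h), ← formIdeal_span_singleton]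
  exact formIdeal_isPrime _

theorem formIdeal_strictMono : StrictMono (formIdeal : Submodule K (Form K ℓ) → _) := by
  intro U' U h
  refine lt_of_le_of_ne (Ideal.span_mono (Set.image_mono h.le)) fun he => h.not_ge fun φ hφ => ?_
  exact mem_of_toPoly_mem_formIdeal (he ▸ toPoly_mem_formIdeal hφ)

/-- Krull's height theorem: a basis of `U` generates `formIdeal U`. -/
theorem height_formIdeal_le (U : Submodule K (Form K ℓ)) :
    (formIdeal U).height ≤ Module.finrank K U := by
  have : Module.Free K U := Module.Free.of_divisionRing K U
  let b := Module.finBasis K U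
  let s : Set (MvPolynomial (Fin (ℓ + 1)) K) := Set.range fun i => toPoly (b i : Form K ℓ)
  have hs : formIdeal U = Ideal.span s := by
    apply le_antisymm
    · rw [formIdeal, Ideal.span_le]
      rintro _ ⟨φ, hφ, rfl⟩
      have : φ = ∑ i, b.repr ⟨φ, hφ⟩ i • (b i : Form K ℓ) := by
        have h := congrArg Subtype.val (b.sum_repr ⟨φ, hφ⟩)
        rw [AddSubmonoidClass.coe_finsetSum] at h
        exact h.symm
      have h2 : toPoly φ = ∑ i, C (b.repr ⟨φ, hφ⟩ i) * toPoly (b i : Form K ℓ) := by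
        refine MvPolynomial.funext fun v => ?_
        conv_lhs => rw [eval_toPoly, this]
        simp [eval_toPoly]
      rw [h2]
      exact Ideal.sum_mem _ fun i _ => Ideal.mul_mem_left _ _ (Ideal.subset_span ⟨i, rfl⟩)
    · rw [Ideal.span_le]
      rintro _ ⟨i, rfl⟩
      exact toPoly_mem_formIdeal (b i).2
  have hp : formIdeal U ∈ (Ideal.span s).minimalPrimes := by
    have := formIdeal_isPrime U
    rw [← hs, Ideal.minimalPrimes_eq_subsingleton_self]
    exact rfl
  refine (Ideal.height_le_card_of_mem_minimalPrimes_span (Set.finite_range _) hp).trans ?_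
  rw [Nat.cast_le, ← Set.image_univ]
  refine (Set.ncard_image_le Set.finite_univ).trans ?_
  simp [Set.ncard_univ]

/-- A full flag of subspaces of `U` gives a chain of primes below `formIdeal U`. -/
theorem finrank_le_height_formIdeal (U : Submodule K (Form K ℓ)) :
    (Module.finrank K U : ℕ∞) ≤ (formIdeal U).height := by
  induction U using WellFoundedLT.induction with
  | ind U ih =>
  rcases eq_or_ne U ⊥ with rfl | hU
  · simp
  obtain ⟨U', -, hU'⟩ := exists_le_covBy_of_lt (bot_lt_iff_ne_bot.2 hU)
  obtain ⟨u, hu, hu'⟩ := SetLike.exists_of_lt hU'.lt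
  have hsup : U' ⊔ Submodule.span K {u} = U := by
    refine (hU'.eq_or_eq le_sup_left (sup_le hU'.le (by simpa using hu))).resolve_left fun h => hu' ?_
    rw [← h]
    exact Submodule.mem_sup_right (Submodule.mem_span_singleton_self u)
  have h1 : Module.finrank K U ≤ Module.finrank K U' + 1 := by
    rw [← hsup]
    refine (Submodule.finrank_add_le_finrank_add_finrank _ _).trans ?_
    gcongr
    simpa using finrank_span_le_card (R := K) ({u} : Set (Form K ℓ))
  have := formIdeal_isPrime U
  have := formIdeal_isPrime U'
  calc (Module.finrank K U : ℕ∞) ≤ Module.finrank K U' + 1 := by exact_mod_cast h1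
    _ ≤ (formIdeal U').height + 1 := by gcongr; exact ih U' hU'.lt
    _ ≤ _ := Ideal.height_add_one_le_of_lt_of_isPrime (formIdeal_strictMono hU'.lt)

end Infinite

/-! ### The Jacobian ideal -/

theorem exists_eq_smul_of_forall_eq_zero {φ ψ : Form K ℓ} (hφ : φ ≠ 0)
    (h : ∀ v, φ v = 0 → ψ v = 0) : ∃ c : K, ψ = c • φ := by
  obtain ⟨v, hv⟩ : ∃ v, φ v ≠ 0 := by
    by_contra! h0
    exact hφ (LinearMap.ext h0)
  refine ⟨ψ v / φ v, LinearMap.ext fun x => ?_⟩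
  have := h (x - (φ x / φ v) • v) (by simp [hv])
  rw [map_sub, map_smul, sub_eq_zero] at this
  rw [this, LinearMap.smul_apply, smul_eq_mul, smul_eq_mul]
  ring

/-- The quotient `Q(A) / α_j` of the defining polynomial by one of its linear factors. -/
noncomputable def cofactor (α : Fin n → Form K ℓ) (j : Fin n) : MvPolynomial (Fin (ℓ + 1)) K :=
  ∏ i ∈ Finset.univ.erase j, toPoly (α i)

/-- The polynomial `∑ t_j Q(A) / α_j`, as a linear function of `t ∈ K^n`. -/
noncomputable def cofactorSum (α : Fin n → Form K ℓ) :
    (Fin n → K) →ₗ[K] MvPolynomial (Fin (ℓ + 1)) K :=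
  Fintype.linearCombination K (cofactor α)

/-- The linear map `v ↦ (α_1(v), …, α_n(v))` from `V` to `K^n`. -/
def evalForms (α : Fin n → Form K ℓ) : (Fin (ℓ + 1) → K) →ₗ[K] (Fin n → K) :=
  LinearMap.pi α

theorem cofactorSum_apply (α : Fin n → Form K ℓ) (t : Fin n → K) :
    cofactorSum α t = ∑ j, C (t j) * cofactor α j := by
  simp [cofactorSum, Fintype.linearCombination_apply, smul_eq_C_mul]

theorem evalForms_apply (α : Fin n → Form K ℓ) (v : Fin (ℓ + 1) → K) (j : Fin n) :
    evalForms α v j = α j v := rfl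

theorem toPoly_mul_cofactor (α : Fin n → Form K ℓ) (j : Fin n) :
    toPoly (α j) * cofactor α j = definingPoly α :=
  Finset.mul_prod_erase _ _ (Finset.mem_univ j)

theorem toPoly_dvd_cofactor (α : Fin n → Form K ℓ) {i j : Fin n} (h : i ≠ j) :
    toPoly (α i) ∣ cofactor α j :=
  Finset.dvd_prod_of_mem _ (Finset.mem_erase.2 ⟨h, Finset.mem_univ i⟩)

theorem isHomogeneous_cofactor (α : Fin n → Form K ℓ) (j : Fin n) :
    (cofactor α j).IsHomogeneous (n - 1) := by
  have := IsHomogeneous.prod (Finset.univ.erase j) (fun i => toPoly (α i)) (fun _ => 1)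
    fun i _ => isHomogeneous_toPoly (α i)
  rw [cofactor]
  simpa [Finset.card_erase_of_mem] using this

theorem isHomogeneous_cofactorSum (α : Fin n → Form K ℓ) (t : Fin n → K) :
    (cofactorSum α t).IsHomogeneous (n - 1) := by
  rw [cofactorSum_apply]
  refine IsHomogeneous.sum _ _ _ fun j _ => ?_
  simpa using (isHomogeneous_C _ (t j)).mul (isHomogeneous_cofactor α j)

theorem pderiv_definingPoly (α : Fin n → Form K ℓ) (i : Fin (ℓ + 1)) :
    pderiv i (definingPoly α) = ∑ j, C (α j (Pi.single i 1)) * cofactor α j := by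
  have key (s : Finset (Fin n)) : pderiv i (∏ j ∈ s, toPoly (α j))
      = ∑ j ∈ s, C (α j (Pi.single i 1)) * ∏ m ∈ s.erase j, toPoly (α m) := by
    induction s using Finset.induction_on with
    | empty => simp
    | insert a s ha ih =>
      rw [Finset.prod_insert ha, Derivation.leibniz, ih, Finset.sum_insert ha,
        Finset.erase_insert ha, pderiv_toPoly, smul_eq_mul, smul_eq_mul, Finset.mul_sum,
        add_comm (Finset.sum _ _), mul_comm _ (C _)]
      congr 1
      refine Finset.sum_congr rfl fun j hj => ?_
      have haj : a ≠ j := fun h => ha (h ▸ hj)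
      rw [Finset.erase_insert_of_ne haj, Finset.prod_insert fun h => ha (Finset.mem_of_mem_erase h)]
      ring
  exact key _

theorem sum_mul_pderiv_definingPoly (α : Fin n → Form K ℓ)
    (g : Fin (ℓ + 1) → MvPolynomial (Fin (ℓ + 1)) K) :
    ∑ i, g i * pderiv i (definingPoly α)
      = ∑ j, (∑ i, g i * C (α j (Pi.single i 1))) * cofactor α j := by
  simp_rw [pderiv_definingPoly, Finset.mul_sum, Finset.sum_mul]
  rw [Finset.sum_comm]
  simp_rw [mul_assoc]

theorem form_apply_eq_sum (φ : Form K ℓ) (v : Fin (ℓ + 1) → K) :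
    φ v = ∑ i, v i * φ (Pi.single i 1) := by
  conv_lhs => rw [pi_eq_sum_univ' v]
  simp

theorem mem_jacobianIdeal_iff (α : Fin n → Form K ℓ) (f : MvPolynomial (Fin (ℓ + 1)) K) :
    f ∈ jacobianIdeal α ↔ ∃ g : Fin (ℓ + 1) → MvPolynomial (Fin (ℓ + 1)) K,
      ∑ j, (∑ i, g i * C (α j (Pi.single i 1))) * cofactor α j = f := by
  simp_rw [jacobianIdeal, Ideal.mem_span_range_iff_exists_fun, sum_mul_pderiv_definingPoly]

theorem cofactorSum_evalForms_mem (α : Fin n → Form K ℓ) (v : Fin (ℓ + 1) → K) :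
    cofactorSum α (evalForms α v) ∈ jacobianIdeal α := by
  refine (mem_jacobianIdeal_iff α _).2 ⟨fun i => C (v i), ?_⟩
  rw [cofactorSum_apply]
  refine Finset.sum_congr rfl fun j _ => ?_
  rw [evalForms_apply, form_apply_eq_sum]
  simp

/-- Euler's formula puts `n Q(A)` into the Jacobian ideal. -/
theorem definingPoly_mem_jacobianIdeal [CharZero K] (α : Fin n → Form K ℓ) (hn : n ≠ 0) :
    definingPoly α ∈ jacobianIdeal α := by
  have h : (n : MvPolynomial (Fin (ℓ + 1)) K) * definingPoly α ∈ jacobianIdeal α := by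
    refine (mem_jacobianIdeal_iff α _).2 ⟨X, ?_⟩
    have h (j : Fin n) : ∑ i, X i * C (α j (Pi.single i 1)) = toPoly (α j) := by
      simp [toPoly, mul_comm]
    simp_rw [h, toPoly_mul_cofactor]
    simp
  have h2 := Ideal.mul_mem_left _ (C (n : K)⁻¹) h
  rwa [← mul_assoc, ← map_natCast C, ← C_mul, inv_mul_cancel₀ (by exact_mod_cast hn), C_1,
    one_mul] at h2

section Infinite

variable [Infinite K]

theorem not_toPoly_dvd_toPoly {α : Fin n → Form K ℓ} (hα : IsArrangement α) {i j : Fin n}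
    (h : i ≠ j) : ¬ toPoly (α i) ∣ toPoly (α j) := by
  intro hd
  obtain ⟨c, hc⟩ := exists_eq_smul_of_forall_eq_zero (hα.1 i) fun v hv => by
    rw [← eval_toPoly (α j)]
    exact toPoly_dvd_iff.1 hd v hv
  have hc0 : c ≠ 0 := by
    rintro rfl
    exact hα.1 j (by rw [hc, zero_smul])
  exact hα.2 j i h.symm (by rw [hc, LinearMap.ker_smul _ _ hc0])

theorem not_toPoly_dvd_cofactor {α : Fin n → Form K ℓ} (hα : IsArrangement α) (j : Fin n) :
    ¬ toPoly (α j) ∣ cofactor α j := by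
  intro hd
  obtain ⟨i, hi, h⟩ := (prime_toPoly (hα.1 j)).exists_mem_finset_dvd hd
  exact not_toPoly_dvd_toPoly hα (Finset.ne_of_mem_erase hi).symm h

/-- A syzygy of the `Q(A) / α_j` has its `j`-th coefficient divisible by `α_j`: all the other
terms vanish on `H_j`. -/
theorem toPoly_dvd_of_sum_mul_cofactor_eq_zero {α : Fin n → Form K ℓ} (hα : IsArrangement α)
    {h : Fin n → MvPolynomial (Fin (ℓ + 1)) K} (h0 : ∑ j, h j * cofactor α j = 0) (j : Fin n) :
    toPoly (α j) ∣ h j := by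
  refine ((prime_toPoly (hα.1 j)).dvd_or_dvd ?_).resolve_right (not_toPoly_dvd_cofactor hα j)
  rw [← Finset.add_sum_erase _ _ (Finset.mem_univ j)] at h0
  rw [eq_neg_of_add_eq_zero_left h0, dvd_neg]
  exact Finset.dvd_sum fun i hi =>
    (toPoly_dvd_cofactor α (Finset.ne_of_mem_erase hi).symm).mul_left _

/-- On `H_j` a relation `f ∑ t_j Q(A) / α_j = ∑ g_i ∂_i Q(A)` becomes `f t_j = ∑ g_i α_j(e_i)`. At
a point `v` with `f(v) ≠ 0`, the vector `w = g(v) / f(v)` serves all the `H_j` through `v`. -/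
theorem exists_eq_of_mul_cofactorSum_mem {α : Fin n → Form K ℓ} (hα : IsArrangement α)
    {t : Fin n → K} {f : MvPolynomial (Fin (ℓ + 1)) K}
    (h : f * cofactorSum α t ∈ jacobianIdeal α) {v : Fin (ℓ + 1) → K} (hv : eval v f ≠ 0) :
    ∃ w, ∀ j, α j v = 0 → t j = α j w := by
  obtain ⟨g, hg⟩ := (mem_jacobianIdeal_iff α _).1 h
  refine ⟨fun i => (eval v f)⁻¹ * eval v (g i), fun j hj => ?_⟩
  have h0 : ∑ j, (∑ i, g i * C (α j (Pi.single i 1)) - f * C (t j)) * cofactor α j = 0 := by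
    simp_rw [sub_mul, Finset.sum_sub_distrib]
    rw [hg, cofactorSum_apply, Finset.mul_sum, sub_eq_zero]
    exact Finset.sum_congr rfl fun j _ => (mul_assoc _ _ _).symm
  have h1 := toPoly_dvd_iff.1 (toPoly_dvd_of_sum_mul_cofactor_eq_zero hα h0 j) v hj
  rw [form_apply_eq_sum]
  simp only [map_sub, map_sum, map_mul, eval_C] at h1
  simp_rw [mul_assoc]
  rw [← Finset.mul_sum, sub_eq_zero.1 h1, inv_mul_cancel_left₀ hv]

theorem cofactorSum_mem_jacobianIdeal_iff {α : Fin n → Form K ℓ} (hα : IsArrangement α)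
    {t : Fin n → K} : cofactorSum α t ∈ jacobianIdeal α ↔ t ∈ LinearMap.range (evalForms α) := by
  constructor
  · intro h
    rw [← one_mul (cofactorSum α t)] at h
    obtain ⟨w, hw⟩ := exists_eq_of_mul_cofactorSum_mem hα h (v := 0) (by simp)
    exact ⟨w, funext fun j => (hw j (map_zero _)).symm⟩
  · rintro ⟨v, rfl⟩
    exact cofactorSum_evalForms_mem α v

end Infinite

/-! ### Localization and divisibility in commutative rings -/

/-- An element of the saturation lies in the localization of `I` at every prime of height at
most `k`, because no primary component of height above `k` is contained in such a prime. -/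
theorem exists_notMem_mul_mem_of_mem_codimSaturation {R : Type*} [CommRing R] [IsNoetherianRing R]
    {I : Ideal R} {k : ℕ} {x : R} (hx : x ∈ codimSaturation I k) {p : Ideal R} [hp : p.IsPrime]
    (hpk : p.height ≤ k) : ∃ f ∉ p, f * x ∈ I := by
  obtain ⟨s, hs⟩ : ∃ s : Finset (Ideal R), Submodule.IsMinimalPrimaryDecomposition I s :=
    Submodule.IsLasker.exists_isMinimalPrimaryDecomposition (Submodule.isLasker R R) I
  have hf : ∀ q : Ideal R, q ∈ s → ∃ f ∉ p, f * x ∈ q := by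
    intro q hq
    by_cases hqk : q.radical.height ≤ k
    · refine ⟨1, p.one_notMem, ?_⟩
      rw [one_mul]
      exact Submodule.mem_sInf.1 hx q ⟨s, hs, hq, hqk⟩
    · obtain ⟨f, hf, hfp⟩ := SetLike.not_le_iff_exists.1 fun hle : q ≤ p =>
        hqk ((Ideal.height_mono (hp.radical_le_iff.2 hle)).trans hpk)
      exact ⟨f, hfp, q.mul_mem_right _ hf⟩
  choose! f hfp hfx using hf
  refine ⟨∏ q ∈ s, f q, fun h => ?_, ?_⟩
  · obtain ⟨q, hq, h⟩ := hp.prod_mem_iff.1 h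
    exact hfp q hq h
  · rw [← hs.inf_eq, Submodule.mem_finsetInf]
    intro (q : Ideal R) hq
    rw [← Finset.mul_prod_erase _ _ hq, mul_right_comm]
    exact q.mul_mem_right _ (hfx q hq)

/-- If `b` is a product of primes and, for each of these primes, `b` divides a multiple of `x` by
a factor not divisible by that prime, then `b` divides `x`. -/
theorem prod_dvd_of_forall_dvd_mul {R ι : Type*} [CommRing R] [IsDomain R] (s : Finset ι)
    {b f : ι → R} (hb : ∀ i ∈ s, Prime (b i)) (hf : ∀ i ∈ s, ¬ b i ∣ f i) {x : R}
    (h : ∀ i ∈ s, ∏ m ∈ s, b m ∣ f i * x) : ∏ m ∈ s, b m ∣ x := by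
  classical
  induction s using Finset.induction_on generalizing x with
  | empty => simp
  | insert a s ha ih =>
    simp only [Finset.forall_mem_insert] at hb hf h
    rw [Finset.prod_insert ha] at h ⊢
    obtain ⟨y, rfl⟩ := (hb.1.dvd_or_dvd ((Dvd.intro _ rfl).trans h.1)).resolve_left hf.1
    refine mul_dvd_mul_left _ (ih hb.2 hf.2 fun i hi => ?_)
    have := h.2 i hi
    rw [mul_left_comm] at this
    exact (mul_dvd_mul_iff_left hb.1.ne_zero).1 this

/-! ### The saturation in degree `n - 1` -/

theorem mem_dualCoannihilator_span {S : Set (Form K ℓ)} {v : Fin (ℓ + 1) → K} :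
    v ∈ (Submodule.span K S).dualCoannihilator ↔ ∀ φ ∈ S, φ v = 0 := by
  rw [Submodule.mem_dualCoannihilator]
  refine ⟨fun h φ hφ => h φ (Submodule.subset_span hφ), fun h φ hφ => ?_⟩
  induction hφ using Submodule.span_induction with
  | mem φ hφ => exact h φ hφ
  | zero => rfl
  | add φ ψ _ _ h1 h2 => simp [h1, h2]
  | smul c φ _ h1 => simp [h1]

/-- The coefficient vectors `t ∈ K^n` that agree, on every set of labels of rank at most `k`, with
the values `α_j(v)` of the forms at some vector `v` (depending on the set). -/
def locallyEvalForms (α : Fin n → Form K ℓ) (k : ℕ) : Submodule K (Fin n → K) where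
  carrier := {t | ∀ X, rankOn α X ≤ k → ∃ v, ∀ j ∈ X, t j = α j v}
  zero_mem' := fun _ _ => ⟨0, by simp⟩
  add_mem' := by
    intro s t hs ht X hX
    obtain ⟨v, hv⟩ := hs X hX
    obtain ⟨w, hw⟩ := ht X hX
    exact ⟨v + w, fun j hj => by simp [hv j hj, hw j hj]⟩
  smul_mem' := by
    intro c t ht X hX
    obtain ⟨v, hv⟩ := ht X hX
    exact ⟨c • v, fun j hj => by simp [hv j hj]⟩

theorem range_evalForms_le (α : Fin n → Form K ℓ) (k : ℕ) :
    LinearMap.range (evalForms α) ≤ locallyEvalForms α k := by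
  rintro _ ⟨v, rfl⟩ X _
  exact ⟨v, fun j _ => rfl⟩

theorem rankOn_pair_le (α : Fin n → Form K ℓ) (i j : Fin n) : rankOn α {i, j} ≤ 2 := by
  rw [rankOn, Set.image_pair]
  classical
  have := finrank_span_finset_le_card (R := K) ({α i, α j} : Finset (Form K ℓ))
  rw [Finset.coe_pair] at this
  exact this.trans Finset.card_le_two

section Infinite

variable [Infinite K]

/-- The prime ideal of the common zeros of the `α_j`, `j ∈ X`, has height at most the rank of `X`,
so an element of the saturation lies in the localization of the Jacobian ideal there. -/
theorem exists_mul_mem_jacobianIdeal_of_rankOn_le {α : Fin n → Form K ℓ} {k : ℕ}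
    {P : MvPolynomial (Fin (ℓ + 1)) K} (hP : P ∈ jacobianSaturation α k) {X : Set (Fin n)}
    (hX : rankOn α X ≤ k) :
    ∃ f : MvPolynomial (Fin (ℓ + 1)) K, f * P ∈ jacobianIdeal α ∧
      ∃ v, (∀ j ∈ X, α j v = 0) ∧ eval v f ≠ 0 := by
  have := formIdeal_isPrime (Submodule.span K (α '' X))
  obtain ⟨f, hf, hfP⟩ := exists_notMem_mul_mem_of_mem_codimSaturation hP
    ((height_formIdeal_le (Submodule.span K (α '' X))).trans (by exact_mod_cast hX))
  rw [mem_formIdeal_iff] at hf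
  push Not at hf
  obtain ⟨v, hv, hvf⟩ := hf
  exact ⟨f, hfP, v, fun j hj => mem_dualCoannihilator_span.1 hv _ ⟨j, hj, rfl⟩, hvf⟩

theorem mem_locallyEvalForms_of_cofactorSum_mem {α : Fin n → Form K ℓ} (hα : IsArrangement α)
    {k : ℕ} {t : Fin n → K} (ht : cofactorSum α t ∈ jacobianSaturation α k) :
    t ∈ locallyEvalForms α k := by
  intro X hX
  obtain ⟨f, hf, v, hv, hvf⟩ := exists_mul_mem_jacobianIdeal_of_rankOn_le ht hX
  obtain ⟨w, hw⟩ := exists_eq_of_mul_cofactorSum_mem hα hf hvf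
  exact ⟨w, fun j hj => hw j (hv j hj)⟩

/-- Let `p` be the radical of a primary component of height at most `k`, and `X` the set of the
labels `j` with `α_j ∈ p`; its rank is at most `k`. After subtracting an element of the Jacobian
ideal, only the terms `Q(A) / α_j` with `j ∉ X` remain, and these are multiples of `Q(A)` up to
the factor `α_j`, a unit at `p`. -/
theorem cofactorSum_mem_of_mem_locallyEvalForms [CharZero K] {α : Fin n → Form K ℓ} (hn : n ≠ 0)
    {k : ℕ} {t : Fin n → K} (ht : t ∈ locallyEvalForms α k) :
    cofactorSum α t ∈ jacobianSaturation α k := by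
  classical
  refine Submodule.mem_sInf.2 ?_
  rintro (q : Ideal (MvPolynomial (Fin (ℓ + 1)) K)) ⟨s, hs, hqs, hqk⟩
  have hq : Ideal.IsPrimary q := hs.primary hqs
  have hp := Ideal.isPrime_radical hq
  have hJq : jacobianIdeal α ≤ q := by
    rw [← hs.inf_eq]
    exact Finset.inf_le (f := id) hqs
  set X : Set (Fin n) := {j | toPoly (α j) ∈ q.radical}
  have hX : rankOn α X ≤ k := by
    have hle : formIdeal (Submodule.span K (α '' X)) ≤ q.radical := by
      rw [formIdeal, Ideal.span_le]
      rintro _ ⟨φ, hφ, rfl⟩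
      induction hφ using Submodule.span_induction with
      | mem φ hφ => obtain ⟨j, hj, rfl⟩ := hφ; exact hj
      | zero => rw [toPoly_zero]; exact zero_mem _
      | add φ ψ _ _ h1 h2 => rw [toPoly_add]; exact add_mem h1 h2
      | smul c φ _ h1 => rw [toPoly_smul]; exact Ideal.mul_mem_left _ _ h1
    exact_mod_cast (finrank_le_height_formIdeal _).trans ((Ideal.height_mono hle).trans hqk)
  obtain ⟨w, hw⟩ := ht X hX
  set U : MvPolynomial (Fin (ℓ + 1)) K := ∏ j with j ∉ X, toPoly (α j) with hU
  have hUq : U ∉ q.radical := fun h => by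
    obtain ⟨j, hj, h⟩ := hp.prod_mem_iff.1 h
    exact (Finset.mem_filter.1 hj).2 h
  have hmem : U * cofactorSum α t ∈ q := by
    apply hJq
    have h1 : U * cofactorSum α (t - evalForms α w) ∈ jacobianIdeal α := by
      rw [cofactorSum_apply, Finset.mul_sum]
      refine Ideal.sum_mem _ fun j _ => ?_
      by_cases hj : j ∈ X
      · simp [hw j hj, evalForms_apply]
      · have hjU : j ∈ Finset.univ.filter (· ∉ X) := by simpa using hj
        rw [hU, ← Finset.mul_prod_erase _ _ hjU, mul_left_comm, mul_right_comm,
          toPoly_mul_cofactor]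
        exact Ideal.mul_mem_left _ _
          (Ideal.mul_mem_right _ _ (definingPoly_mem_jacobianIdeal α hn))
    rw [map_sub, mul_sub] at h1
    exact (Submodule.sub_mem_iff_left _
      (Ideal.mul_mem_left _ _ (cofactorSum_evalForms_mem α w))).1 h1
  rw [mul_comm] at hmem
  exact ((Ideal.isPrimary_iff.1 hq).2 hmem).resolve_right hUq

/-- Restricted to `H_j`, the Jacobian ideal is generated by `Q(A) / α_j`, a product of linear
forms. An element of the saturation is locally divisible by it at each of the codimension two
flats in `H_j`, hence divisible by it. -/
theorem exists_dvd_sub_cofactor {α : Fin n → Form K ℓ} (hα : IsArrangement α) {k : ℕ} (hk : 2 ≤ k)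
    {P : MvPolynomial (Fin (ℓ + 1)) K} (hP : P ∈ jacobianSaturation α k)
    (hdeg : P.IsHomogeneous (n - 1)) (j : Fin n) :
    ∃ c : K, toPoly (α j) ∣ P - C c * cofactor α j := by
  obtain ⟨π, hπ, hπ'⟩ := exists_retraction (LinearMap.ker (α j))
  simp only [LinearMap.mem_ker] at hπ hπ'
  have hdvd {f : MvPolynomial (Fin (ℓ + 1)) K} : toPoly (α j) ∣ f ↔ subst π f = 0 := by
    rw [toPoly_dvd_iff]
    refine ⟨fun h => MvPolynomial.funext fun v => ?_, fun h v hv => ?_⟩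
    · rw [eval_subst, h _ (hπ v), map_zero]
    · rw [← hπ' v hv, ← eval_subst, h, map_zero]
  have hcof : subst π (cofactor α j) = ∏ i ∈ Finset.univ.erase j, toPoly (α i ∘ₗ π) := by
    simp [cofactor, subst_toPoly]
  have hJ {f : MvPolynomial (Fin (ℓ + 1)) K} (hf : f ∈ jacobianIdeal α) :
      subst π (cofactor α j) ∣ subst π f := by
    obtain ⟨g, rfl⟩ := (mem_jacobianIdeal_iff α f).1 hf
    rw [map_sum]
    refine Finset.dvd_sum fun i _ => ?_
    rw [map_mul]
    rcases eq_or_ne j i with rfl | hij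
    · exact Dvd.intro_left _ rfl
    · rw [hdvd.1 (toPoly_dvd_cofactor α hij), mul_zero]
      exact dvd_zero _
  have hne : ∀ i ∈ Finset.univ.erase j, α i ∘ₗ π ≠ 0 := by
    intro i hi h0
    refine not_toPoly_dvd_toPoly hα (Finset.ne_of_mem_erase hi).symm (hdvd.2 ?_)
    rw [subst_toPoly, h0, toPoly_zero]
  have hf : ∀ i, ∃ f : MvPolynomial (Fin (ℓ + 1)) K, f * P ∈ jacobianIdeal α ∧
      ∃ v, (∀ m ∈ ({i, j} : Set (Fin n)), α m v = 0) ∧ eval v f ≠ 0 := fun i =>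
    exists_mul_mem_jacobianIdeal_of_rankOn_le hP ((rankOn_pair_le α i j).trans hk)
  choose f hfJ v hv hvf using hf
  have hdiv : subst π (cofactor α j) ∣ subst π P := by
    rw [hcof]
    refine prod_dvd_of_forall_dvd_mul (f := fun i => subst π (f i)) _
      (fun i hi => prime_toPoly (hne i hi)) (fun i hi hd => ?_) (fun i hi => ?_)
    · have h1 : π (v i) = v i := hπ' _ (hv i j (by simp))
      have h2 := toPoly_dvd_iff.1 hd (v i) (by simp [h1, hv i i])
      rw [eval_subst, h1] at h2
      exact hvf i h2
    · rw [← hcof, ← map_mul]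
      exact hJ (hfJ i)
  obtain ⟨h, hh⟩ := hdiv
  have hhom {F : MvPolynomial (Fin (ℓ + 1)) K} (hF : F.IsHomogeneous (n - 1)) :
      (subst π F).IsHomogeneous (n - 1) := by
    have := hF.aeval (fun i => toPoly (LinearMap.proj i ∘ₗ π)) (n := 1)
      fun i => isHomogeneous_toPoly _
    rwa [one_mul] at this
  have hconst : ∃ c : K, subst π P = C c * subst π (cofactor α j) := by
    -- Both restrictions have degree `n - 1`, unless that of `P` is zero.
    rcases eq_or_ne (subst π P) 0 with h0 | h0
    · exact ⟨0, by simp [h0]⟩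
    have hc0 : subst π (cofactor α j) ≠ 0 := fun h => h0 (by rw [hh, h, zero_mul])
    have hh0 : h ≠ 0 := fun h => h0 (by rw [hh, h, mul_zero])
    have h1 := totalDegree_mul_of_isDomain hc0 hh0
    rw [← hh, (hhom hdeg).totalDegree h0,
      (hhom (isHomogeneous_cofactor α j)).totalDegree hc0] at h1
    have h2 := totalDegree_eq_zero_iff_eq_C.1 (Nat.add_eq_left.1 h1.symm)
    exact ⟨_, by rw [hh, mul_comm, ← h2]⟩
  obtain ⟨c, hc⟩ := hconst
  refine ⟨c, hdvd.2 ?_⟩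
  rw [map_sub, map_mul, hc]
  simp [subst]

/-- The difference of `P` and `∑ t_j Q(A) / α_j`, with the constants `t_j` read off on the `H_j`, is
divisible by every `α_j`, hence by `Q(A)`, whose degree is too large. -/
theorem exists_eq_cofactorSum {α : Fin n → Form K ℓ} (hα : IsArrangement α) (hn : n ≠ 0) {k : ℕ}
    (hk : 2 ≤ k) {P : MvPolynomial (Fin (ℓ + 1)) K} (hP : P ∈ jacobianSaturation α k)
    (hdeg : P.IsHomogeneous (n - 1)) : ∃ t, P = cofactorSum α t := by
  choose t ht using exists_dvd_sub_cofactor hα hk hP hdeg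
  refine ⟨t, sub_eq_zero.1 ?_⟩
  have hdvd (j : Fin n) : toPoly (α j) ∣ P - cofactorSum α t := by
    rw [cofactorSum_apply, ← Finset.add_sum_erase _ _ (Finset.mem_univ j), ← sub_sub]
    exact (ht j).sub (Finset.dvd_sum fun i hi =>
      (toPoly_dvd_cofactor α (Finset.ne_of_mem_erase hi).symm).mul_left _)
  have hQ : definingPoly α ∣ P - cofactorSum α t := by
    -- `α_j` does not divide `Q / α_j`, while `Q = α_j (Q / α_j)` divides `(Q / α_j) (P - ∑ …)`.
    refine prod_dvd_of_forall_dvd_mul (f := cofactor α) _ (fun j _ => prime_toPoly (hα.1 j))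
      (fun j _ => not_toPoly_dvd_cofactor hα j) fun j _ => ?_
    change definingPoly α ∣ _
    rw [← toPoly_mul_cofactor α j, mul_comm]
    exact mul_dvd_mul_left _ (hdvd j)
  by_contra h0
  obtain ⟨h, hh⟩ := hQ
  have hQ0 : definingPoly α ≠ 0 := fun h1 => h0 (by rw [hh, h1, zero_mul])
  have hh0 : h ≠ 0 := fun h1 => h0 (by rw [hh, h1, mul_zero])
  have h1 := totalDegree_mul_of_isDomain hQ0 hh0
  have hQhom : (definingPoly α).IsHomogeneous n := by
    have := IsHomogeneous.prod Finset.univ (fun i => toPoly (α i)) (fun _ => 1)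
      fun i _ => isHomogeneous_toPoly (α i)
    rw [definingPoly]
    simpa using this
  rw [← hh, (hdeg.sub (isHomogeneous_cofactorSum α t)).totalDegree h0,
    hQhom.totalDegree hQ0] at h1
  omega

end Infinite

end Polynomials

/-! ### General position and weak perspective representations -/

theorem mem_zeroLocus {α : Fin n → Form K ℓ} {X : Set (Fin n)} {v : Fin (ℓ + 1) → K} :
    v ∈ zeroLocus α X ↔ ∀ j ∈ X, α j v = 0 := by
  simp [zeroLocus, Submodule.mem_iInf]

theorem zeroLocus_eq_dualCoannihilator (α : Fin n → Form K ℓ) (X : Set (Fin n)) :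
    zeroLocus α X = (Submodule.span K (α '' X)).dualCoannihilator := by
  ext v
  rw [mem_zeroLocus, mem_dualCoannihilator_span, Set.forall_mem_image]

theorem rankOn_mono (α : Fin n → Form K ℓ) {X Y : Set (Fin n)} (h : X ⊆ Y) :
    rankOn α X ≤ rankOn α Y :=
  Submodule.finrank_mono (Submodule.span_mono (Set.image_mono h))

theorem rank_le (α : Fin n → Form K ℓ) : rank α ≤ ℓ + 1 := by
  refine (Submodule.finrank_le _).trans ?_
  simp [Subspace.dual_finrank_eq]

theorem InGeneralPosition.mono {α : Fin n → Form K ℓ} {k m : ℕ} {α₀ : Form K ℓ}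
    (h : InGeneralPosition α m α₀) (hkm : k ≤ m) : InGeneralPosition α k α₀ :=
  ⟨h.1, fun X hX hr => h.2 X hX (hr.trans hkm)⟩

/-- In terms of forms, general position says that `α₀` avoids the spans of the sets of labels of
small rank that are not spanning in `V^*`. -/
theorem InGeneralPosition.notMem_span {α : Fin n → Form K ℓ} {k : ℕ} {α₀ : Form K ℓ}
    (h : InGeneralPosition α k α₀) {X : Set (Fin n)} (hX : rankOn α X ≤ k)
    (hX' : rankOn α X < ℓ + 1) : α₀ ∉ Submodule.span K (α '' X) := by
  intro hmem
  set Y : Set (Fin n) := {j | α j ∈ Submodule.span K (α '' X)}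
  have hXY : X ⊆ Y := fun j hj => Submodule.subset_span ⟨j, hj, rfl⟩
  have hspan : Submodule.span K (α '' Y) = Submodule.span K (α '' X) := by
    refine le_antisymm (Submodule.span_le.2 ?_) (Submodule.span_mono (Set.image_mono hXY))
    rintro _ ⟨j, hj, rfl⟩
    exact hj
  have hr : rankOn α Y = rankOn α X := by rw [rankOn, hspan, rankOn]
  refine h.2 Y (fun j hj => ?_) (hr.trans_le hX) (fun h0 => ?_) fun v hv => ?_
  · rw [hspan] at hj
    exact hj
  · have := Subspace.finrank_add_finrank_dualCoannihilator_eq (Submodule.span K (α '' Y))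
    rw [← zeroLocus_eq_dualCoannihilator, h0, finrank_bot, Module.finrank_fin_fun] at this
    change rankOn α Y + 0 = _ at this
    omega
  · rw [zeroLocus_eq_dualCoannihilator, hspan] at hv
    exact (Submodule.mem_dualCoannihilator v).1 hv _ hmem

/-- Over an infinite field `V^*` is not the union of the finitely many proper subspaces of the forms
that vanish on a given nonempty flat. -/
theorem exists_inGeneralPosition [Infinite K] (α : Fin n → Form K ℓ) (k : ℕ) :
    ∃ α₀, InGeneralPosition α k α₀ := by
  classical
  set s : Finset (Submodule K (Form K ℓ)) :=
    (Finset.univ.filter fun X : Set (Fin n) => zeroLocus α X ≠ ⊥).image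
      fun X => (zeroLocus α X).dualAnnihilator with hs
  have htop : ⊤ ∉ s := by
    intro h
    obtain ⟨X, hX, h⟩ := Finset.mem_image.1 h
    refine (Finset.mem_filter.1 hX).2 ?_
    rw [← Subspace.dualAnnihilator_dualCoannihilator_eq (W := zeroLocus α X), h,
      Submodule.dualCoannihilator_top]
  obtain ⟨α₀, h0⟩ := (Set.ne_univ_iff_exists_notMem _).1
    (Subspace.biUnion_ne_univ_of_top_notMem htop)
  have key : ∀ X, zeroLocus α X ≠ ⊥ → ¬ zeroLocus α X ≤ LinearMap.ker α₀ := by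
    intro X hX hle
    refine h0 (Set.mem_biUnion (Finset.mem_image_of_mem _ (Finset.mem_filter.2
      ⟨Finset.mem_univ X, hX⟩)) ?_)
    exact (Submodule.mem_dualAnnihilator _).2 fun v hv => hle hv
  refine ⟨α₀, ?_, fun X _ _ => key X⟩
  rintro rfl
  -- The empty set of labels, with zero locus `V`, excludes `α₀ = 0`.
  refine key ∅ ?_ (by simp)
  rw [zeroLocus_eq_dualCoannihilator]
  simp

theorem eq_zero_of_smul_mem {p : Submodule K (Form K ℓ)} {α₀ : Form K ℓ} (h : α₀ ∉ p) {s : K}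
    (hs : s • α₀ ∈ p) : s = 0 := by
  by_contra h0
  exact h ((p.smul_mem_iff h0).1 hs)

theorem shift_apply (α : Fin n → Form K ℓ) (α₀ : Form K ℓ) (t : Fin n → K) (j : Fin n) :
    shift α α₀ t j = α j + t j • α₀ := rfl

section Shift

variable {α : Fin n → Form K ℓ} {α₀ : Form K ℓ}

/-- The form `α₀` is not a combination of two of the `α_j`. -/
def AvoidsPairs (α : Fin n → Form K ℓ) (α₀ : Form K ℓ) : Prop :=
  ∀ i j, α₀ ∉ Submodule.span K ({α i, α j} : Set (Form K ℓ))

theorem InGeneralPosition.avoidsPairs (h : InGeneralPosition α 2 α₀) (hr : 3 ≤ rank α) :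
    AvoidsPairs α α₀ := by
  intro i j
  have h1 := rankOn_pair_le α i j
  have h2 := rank_le α
  rw [← Set.image_pair]
  exact h.notMem_span h1 (by omega)

theorem AvoidsPairs.notMem_span_singleton (h : AvoidsPairs α α₀) (j : Fin n) :
    α₀ ∉ Submodule.span K {α j} := by
  simpa using h j j

theorem AvoidsPairs.eq_zero_of_eq_smul (h : AvoidsPairs α α₀) {j : Fin n} {s : K}
    (hs : α j = s • α₀) : α j = 0 := by
  have := eq_zero_of_smul_mem (h.notMem_span_singleton j) (s := s) (by
    rw [← hs]
    exact Submodule.mem_span_singleton_self (α j))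
  rw [hs, this, zero_smul]

theorem AvoidsPairs.isArrangement_shift (h : AvoidsPairs α α₀) (hα : IsArrangement α)
    (t : Fin n → K) : IsArrangement (shift α α₀ t) := by
  have hne : ∀ j, shift α α₀ t j ≠ 0 := fun j h0 => hα.1 j <|
    h.eq_zero_of_eq_smul (s := -t j) (LinearMap.ext fun v => by
      have : α j v + t j * α₀ v = 0 := LinearMap.congr_fun h0 v
      rw [LinearMap.smul_apply, smul_eq_mul]
      linear_combination this)
  refine ⟨hne, fun i j hij hker => ?_⟩
  obtain ⟨c, hc⟩ := exists_eq_smul_of_forall_eq_zero (hne i) fun v hv => by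
    rw [← LinearMap.mem_ker, hker] at hv
    exact hv
  have h1 : (t j - c * t i) • α₀ = c • α i - α j := by
    refine LinearMap.ext fun v => ?_
    have : α j v + t j * α₀ v = c * (α i v + t i * α₀ v) := LinearMap.congr_fun hc v
    change (t j - c * t i) * α₀ v = c * α i v - α j v
    linear_combination this
  have h2 : t j - c * t i = 0 := by
    refine eq_zero_of_smul_mem (h i j) (h1 ▸ sub_mem (Submodule.smul_mem _ _ ?_) ?_) <;>
      exact Submodule.subset_span (by simp)
  rw [h2, zero_smul, eq_comm, sub_eq_zero] at h1
  have hc0 : c ≠ 0 := by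
    rintro rfl
    exact hα.1 j (by rw [← h1, zero_smul])
  exact hα.2 i j hij (by rw [← h1, LinearMap.ker_smul _ _ hc0])

theorem AvoidsPairs.arePerspective_shift (h : AvoidsPairs α α₀) (hα : IsArrangement α)
    (h0 : α₀ ≠ 0) (t : Fin n → K) : ArePerspective α (shift α α₀ t) α₀ := by
  have key (j : Fin n) (s : K) : LinearMap.ker (α j + s • α₀) ≠ LinearMap.ker α₀ := by
    intro hker
    obtain ⟨c, hc⟩ := exists_eq_smul_of_forall_eq_zero h0 fun v (hv : v ∈ LinearMap.ker α₀) => by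
      rw [← hker] at hv
      exact hv
    refine hα.1 j (h.eq_zero_of_eq_smul (s := c - s) (LinearMap.ext fun v => ?_))
    have : α j v + s * α₀ v = c * α₀ v := LinearMap.congr_fun hc v
    change α j v = (c - s) * α₀ v
    linear_combination this
  refine ⟨h0, fun j => by simpa using key j 0, fun j => key j (t j), fun j => ?_⟩
  ext v
  simp only [Submodule.mem_inf, LinearMap.mem_ker, shift_apply, LinearMap.add_apply,
    LinearMap.smul_apply]
  refine and_congr_left fun hv => ?_
  rw [hv, smul_zero, add_zero]

end Shift

theorem linearIndepOn_iff_card_le_rankOn {α : Fin n → Form K ℓ} (D : Finset (Fin n)) :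
    LinearIndepOn K α (D : Set (Fin n)) ↔ D.card ≤ rankOn α D := by
  have h := linearIndependent_iff_card_le_finrank_span (R := K)
    (b := fun i : (D : Set (Fin n)) => α i)
  rw [LinearIndepOn, h, Set.finrank, rankOn, Set.image_eq_range]
  simp

/-- A dependency of the `α_j` among labels in `X` imposes the same linear condition on the values
`t_j = α_j(v)`, so it survives in the shifted forms. -/
theorem isWeakRep_shift_of_mem {α : Fin n → Form K ℓ} {k : ℕ} {t : Fin n → K}
    (ht : t ∈ locallyEvalForms α k) (α₀ : Form K ℓ) : IsWeakRep α (k + 1) (shift α α₀ t) := by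
  rintro D hD ⟨hcard, hind⟩
  have hαD : ¬ LinearIndepOn K α (D : Set (Fin n)) := fun h => hD ⟨hcard, h⟩
  have hr : rankOn α D ≤ k := by
    rw [linearIndepOn_iff_card_le_rankOn] at hαD
    omega
  obtain ⟨v, hv⟩ := ht D hr
  -- On the labels in `D` the shifted forms are the images of the `α_j` under `φ ↦ φ + φ(v) α₀`.
  let L : Form K ℓ →ₗ[K] Form K ℓ :=
    LinearMap.id + (Module.Dual.eval K (Fin (ℓ + 1) → K) v).smulRight α₀
  refine hαD (LinearIndependent.of_comp L ?_)
  have hL : L ∘ (fun j : (D : Set (Fin n)) => α j) = fun j : (D : Set (Fin n)) =>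
      shift α α₀ t j := by
    funext j
    simp [L, shift_apply, hv j j.2]
  rw [hL]
  exact hind

theorem exists_forall_eq_of_linearIndepOn {α : Fin n → Form K ℓ} {B : Set (Fin n)}
    (hB : LinearIndepOn K α B) (t : Fin n → K) : ∃ v, ∀ j ∈ B, t j = α j v := by
  obtain ⟨F, hF⟩ := LinearMap.exists_extend
    (Finsupp.linearCombination K (fun j : B => t j) ∘ₗ LinearIndependent.repr hB)
  obtain ⟨v, rfl⟩ := (Module.evalEquiv K (Fin (ℓ + 1) → K)).surjective F
  refine ⟨v, fun j hj => ?_⟩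
  have hm : α j ∈ Submodule.span K (Set.range fun i : B => α i) :=
    Submodule.subset_span ⟨⟨j, hj⟩, rfl⟩
  have h1 := LinearMap.congr_fun hF ⟨α j, hm⟩
  have h2 := LinearIndependent.repr_eq_single hB ⟨j, hj⟩ ⟨α j, hm⟩ rfl
  simp only [LinearMap.comp_apply, h2] at h1
  simpa using h1.symm

/-- Let `B` be a basis of `X` and `v` with `t_b = α_b(v)` on `B`. For `j ∈ X`, the dependency of
`B ∪ {j}` for `β = α + t α₀` is one of the pairs `(α_i, t_i)`, since `α₀` is not in the span of
the `α_i`; hence `t_j = α_j(v)` as well. -/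
theorem mem_of_isWeakRep_shift {α : Fin n → Form K ℓ} {k : ℕ} {t : Fin n → K} {α₀ : Form K ℓ}
    (h0 : ∀ X, rankOn α X ≤ k → α₀ ∉ Submodule.span K (α '' X))
    (h : IsWeakRep α (k + 1) (shift α α₀ t)) : t ∈ locallyEvalForms α k := by
  classical
  intro X hX
  obtain ⟨B, hBX, -, hspan, hB⟩ :=
    exists_linearIndepOn_extension (linearIndepOn_empty K α) (Set.empty_subset X)
  obtain ⟨v, hv⟩ := exists_forall_eq_of_linearIndepOn hB t
  refine ⟨v, fun j hj => ?_⟩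
  by_cases hjB : j ∈ B
  · exact hv j hjB
  let a : Fin n → Form K ℓ × K := fun i => (α i, t i)
  let L : Form K ℓ × K →ₗ[K] Form K ℓ :=
    LinearMap.fst K _ _ + (LinearMap.snd K _ _).smulRight α₀
  have haB : LinearIndepOn K a B := LinearIndependent.of_comp (LinearMap.fst K _ _) hB
  have hjspan : α j ∈ Submodule.span K (α '' B) := hspan ⟨j, hj, rfl⟩
  -- `B ∪ {j}` is a dependent set of `M(α)` with at most `k + 1` elements.
  have hcard : B.toFinset.card ≤ k := by
    refine le_trans ?_ hX
    refine le_trans ?_ (rankOn_mono α hBX)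
    have := (linearIndepOn_iff_card_le_rankOn (α := α) B.toFinset).1 (by simpa using hB)
    simpa using this
  have hDcoe : ((insert j B.toFinset : Finset (Fin n)) : Set (Fin n)) = insert j B := by simp
  have hβ : ¬ LinearIndepOn K (shift α α₀ t) (insert j B) := by
    intro hind
    refine h (insert j B.toFinset) ?_ ⟨(Finset.card_insert_le _ _).trans (by omega), ?_⟩
    · rintro ⟨-, hi⟩
      rw [hDcoe, linearIndepOn_insert hjB] at hi
      exact hi.2 hjspan
    · rwa [hDcoe]
  have ha : ¬ LinearIndepOn K a (insert j B) := by
    intro hind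
    refine hβ ?_
    -- `L (φ, s) = φ + s α₀` is injective on pairs with `φ` in the span of the `α_i`, `i ∈ X`.
    have := LinearIndependent.map hind (f := L) ?_
    · exact this
    rw [Submodule.disjoint_def]
    rintro ⟨φ, s⟩ hmem hker
    have hφ : φ ∈ Submodule.span K (α '' X) := by
      have hle : Submodule.span K (Set.range fun i : ↥(insert j B) => a i)
          ≤ (Submodule.span K (α '' X)).comap (LinearMap.fst K _ _) := by
        rw [Submodule.span_le]
        rintro _ ⟨⟨i, hi⟩, rfl⟩
        exact Submodule.subset_span ⟨i, Set.insert_subset hj hBX hi, rfl⟩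
      exact hle hmem
    have hφs : φ + s • α₀ = 0 := by simpa [L] using hker
    have hs : s = 0 := by
      refine eq_zero_of_smul_mem (h0 X hX) ?_
      rw [eq_neg_of_add_eq_zero_right hφs]
      exact neg_mem hφ
    rw [hs, zero_smul, add_zero] at hφs
    rw [hs, hφs, Prod.mk_zero_zero]
  rw [linearIndepOn_insert hjB, not_and, not_not] at ha
  have hle : Submodule.span K (a '' B) ≤ LinearMap.ker (LinearMap.snd K (Form K ℓ) K -
      (Module.Dual.eval K (Fin (ℓ + 1) → K) v) ∘ₗ LinearMap.fst K (Form K ℓ) K) := by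
    rw [Submodule.span_le]
    rintro _ ⟨i, hi, rfl⟩
    simp [a, hv i hi]
  have := hle (ha haB)
  simpa [a, sub_eq_zero] using this

theorem coe_locallyEvalForms_eq_weakPReps {α : Fin n → Form K ℓ} (hα : IsArrangement α) {k : ℕ}
    (hk : 2 ≤ k) (hkr : k + 1 ≤ rank α) {α₀ : Form K ℓ} (h0 : InGeneralPosition α (k + 1) α₀) :
    (locallyEvalForms α k : Set (Fin n → K)) = weakPReps α α₀ (k + 1) := by
  have hr := rank_le α
  have h2 : AvoidsPairs α α₀ := (h0.mono (by omega)).avoidsPairs (by omega)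
  ext t
  constructor
  · intro ht
    exact ⟨h0, h2.isArrangement_shift hα t, h2.arePerspective_shift hα h0.1 t,
      isWeakRep_shift_of_mem ht α₀⟩
  · rintro ⟨-, -, -, ht⟩
    exact mem_of_isWeakRep_shift (fun X hX => h0.notMem_span (by omega) (by omega)) ht

/-! ### Trivial perspective representations -/

section Trivial

variable {α : Fin n → Form K ℓ} {α₀ : Form K ℓ}

/-- No `α_i` vanishes on the hyperplane `H₀`, so neither does the product of two of them. -/
theorem AvoidsPairs.exists_ne_zero_ne_zero (h : AvoidsPairs α α₀) (h0 : α₀ ≠ 0)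
    (hα : IsArrangement α) (i j : Fin n) : ∃ x, α₀ x = 0 ∧ α i x ≠ 0 ∧ α j x ≠ 0 := by
  have key (i : Fin n) : ∃ x, α₀ x = 0 ∧ α i x ≠ 0 := by
    by_contra! hx
    obtain ⟨c, hc⟩ := exists_eq_smul_of_forall_eq_zero h0 hx
    exact hα.1 i (h.eq_zero_of_eq_smul hc)
  obtain ⟨x, hx0, hx⟩ := key i
  obtain ⟨y, hy0, hy⟩ := key j
  by_cases hxj : α j x = 0
  · by_cases hyi : α i y = 0
    · exact ⟨x + y, by simp [hx0, hy0], by simpa [hyi] using hx, by simpa [hxj] using hy⟩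
    · exact ⟨y, hy0, hyi, hy⟩
  · exact ⟨x, hx0, hx, hxj⟩

/-- If `β_j = c_j α_j ∘ T⁻¹` with `T` trivial on `H₀`, then comparing with `α_j` on `H₀`, where
`T⁻¹` acts by scalars, all the `c_j` agree. So `t_j α₀ = α_j ∘ (c T⁻¹ - 1)`, to be evaluated at a
vector with `α₀ = 1`. -/
theorem mem_range_evalForms_of_isTrivialWeakPRep (h : AvoidsPairs α α₀) (h0 : α₀ ≠ 0)
    (hα : IsArrangement α) {t : Fin n → K} (ht : IsTrivialWeakPRep α α₀ (shift α α₀ t)) :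
    t ∈ LinearMap.range (evalForms α) := by
  rcases ht.2 with ⟨T, hT, hβ⟩ | ⟨q, hq, hβ⟩
  · choose c hc0 hc using hβ
    have hcT (j : Fin n) (x : Fin (ℓ + 1) → K) : α j x + t j * α₀ x = c j * α j (T.symm x) :=
      LinearMap.congr_fun (hc j) x
    have hcc (i j : Fin n) : c i = c j := by
      obtain ⟨x, hx0, hxi, hxj⟩ := h.exists_ne_zero_ne_zero h0 hα i j
      obtain ⟨d, hd⟩ := hT x hx0
      have hd' : d • T.symm x = x := by rw [← map_smul, ← hd, T.symm_apply_apply]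
      have hsol (m : Fin n) (hm : α m x ≠ 0) : c m = d := by
        have h1 := hcT m x
        rw [hx0, mul_zero, add_zero] at h1
        have h2 : d * α m (T.symm x) = α m x := by rw [← smul_eq_mul, ← map_smul, hd']
        have h3 : α m (T.symm x) ≠ 0 := fun h3 => hm (by rw [← h2, h3, mul_zero])
        exact mul_right_cancel₀ h3 (by rw [← h1, h2])
      rw [hsol i hxi, hsol j hxj]
    obtain ⟨v, hv⟩ : ∃ v, α₀ v = 1 := by
      obtain ⟨v, hv⟩ : ∃ v, α₀ v ≠ 0 := by
        by_contra! h1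
        exact h0 (LinearMap.ext h1)
      exact ⟨(α₀ v)⁻¹ • v, by simp [hv]⟩
    rcases isEmpty_or_nonempty (Fin n) with hn | ⟨⟨i⟩⟩
    · exact ⟨0, Subsingleton.elim _ _⟩
    refine ⟨c i • T.symm v - v, funext fun j => ?_⟩
    have := hcT j v
    rw [hv, hcc j i] at this
    simp only [evalForms_apply, map_sub, map_smul, smul_eq_mul]
    linear_combination -this
  · refine ⟨-(α₀ q)⁻¹ • q, funext fun j => ?_⟩
    have h1 : α j q + t j * α₀ q = 0 := (hβ j).2.1
    rw [evalForms_apply, map_smul, smul_eq_mul, eq_neg_of_add_eq_zero_left h1]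
    field_simp

/-- For `t_j = α_j(w)` one has `β_j = α_j ∘ S` with `S = 1 + w ⊗ α₀`. Either `S` is invertible, or
`α₀(w) = -1` and all the `β_j` vanish at `q = w`. -/
theorem isTrivialWeakPRep_shift_evalForms (h : AvoidsPairs α α₀) (h0 : InGeneralPosition α 2 α₀)
    (hα : IsArrangement α) (w : Fin (ℓ + 1) → K) :
    IsTrivialWeakPRep α α₀ (shift α α₀ (evalForms α w)) := by
  refine ⟨h0, ?_⟩
  by_cases hw : 1 + α₀ w = 0
  · have hw1 : α₀ w = -1 := eq_neg_of_add_eq_zero_right hw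
    refine Or.inr ⟨w, by simp [hw1], fun j => ⟨(h.isArrangement_shift hα _).1 j, ?_, ?_⟩⟩
    · change α j w + α j w * α₀ w = 0
      rw [hw1]
      ring
    · rintro v ⟨hv, hv0⟩
      change α j v + α j w * α₀ v = 0
      rw [LinearMap.mem_ker.1 hv, LinearMap.mem_ker.1 hv0]
      ring
  · refine Or.inl ⟨LinearEquiv.ofLinearMap
      (LinearMap.id - α₀.smulRight ((1 + α₀ w)⁻¹ • w)) (LinearMap.id + α₀.smulRight w) ?_ ?_,
      fun x hx => ⟨1, ?_⟩, fun j => ⟨1, one_ne_zero, ?_⟩⟩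
    · refine LinearMap.ext fun x => funext fun i => ?_
      simp
      field_simp
      ring
    · refine LinearMap.ext fun x => funext fun i => ?_
      simp
      field_simp
      ring
    · have hx0 : α₀ x = 0 := hx
      simp [hx0]
    · refine LinearMap.ext fun x => ?_
      simp [shift_apply, evalForms_apply, mul_comm]

end Trivial

theorem coe_range_evalForms_eq_trivialWeakPReps {α : Fin n → Form K ℓ} (hα : IsArrangement α)
    (hr : 3 ≤ rank α) {α₀ : Form K ℓ} (h0 : InGeneralPosition α 2 α₀) :
    (LinearMap.range (evalForms α) : Set (Fin n → K)) = trivialWeakPReps α α₀ := by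
  have h2 := h0.avoidsPairs hr
  ext t
  constructor
  · rintro ⟨w, rfl⟩
    exact isTrivialWeakPRep_shift_evalForms h2 h0 hα w
  · exact mem_range_evalForms_of_isTrivialWeakPRep h2 h0.1 hα

/-! ### The isomorphism -/

/-- The class of `∑ t_j Q(A) / α_j` in the degree `n - 1` part of the quotient. -/
noncomputable def toQuotient [CharZero K] (α : Fin n → Form K ℓ) (hn : n ≠ 0) (k : ℕ) :
    locallyEvalForms α k →ₗ[K]
      quotientDegreePart (jacobianSaturation α k) (jacobianIdeal α) (n - 1) :=
  let F : locallyEvalForms α k →ₗ[K] jacobianSaturation α k :=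
    { toFun := fun t => ⟨cofactorSum α t, cofactorSum_mem_of_mem_locallyEvalForms hn t.2⟩
      map_add' := fun _ _ => Subtype.ext (map_add _ _ _)
      map_smul' := fun _ _ => Subtype.ext (map_smul _ _ _) }
  LinearMap.codRestrict _ (((Submodule.mkQ (Submodule.submoduleOf (jacobianIdeal α)
    (jacobianSaturation α k))).restrictScalars K) ∘ₗ F)
    fun t => ⟨F t, isHomogeneous_cofactorSum α t, rfl⟩

theorem toQuotient_surjective [CharZero K] {α : Fin n → Form K ℓ} (hα : IsArrangement α)
    (hn : n ≠ 0) {k : ℕ} (hk : 2 ≤ k) : Function.Surjective (toQuotient α hn k) := by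
  rintro ⟨_, ⟨P, hP⟩, hhom, rfl⟩
  obtain ⟨t, rfl⟩ := exists_eq_cofactorSum hα hn hk hP hhom
  exact ⟨⟨t, mem_locallyEvalForms_of_cofactorSum_mem hα hP⟩, rfl⟩

theorem ker_toQuotient [CharZero K] {α : Fin n → Form K ℓ} (hα : IsArrangement α)
    (hn : n ≠ 0) (k : ℕ) : LinearMap.ker (toQuotient α hn k)
      = (LinearMap.range (evalForms α)).submoduleOf (locallyEvalForms α k) := by
  ext t
  change _ ↔ (t : Fin n → K) ∈ LinearMap.range (evalForms α)
  rw [LinearMap.mem_ker, ← cofactorSum_mem_jacobianIdeal_iff hα, Subtype.ext_iff]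
  exact Submodule.Quotient.mk_eq_zero _


end HypArr

theorem corollary5p5 {K : Type*} [Field K] [CharZero K] {ℓ n : ℕ}
    (α : Fin n → HypArr.Form K ℓ) (hα : HypArr.IsArrangement α)
    (k : ℕ) (hk : 2 ≤ k) (hkr : k + 1 ≤ HypArr.rank α) :
    (∃ α₀ : HypArr.Form K ℓ, HypArr.InGeneralPosition α (k + 1) α₀) ∧
    ∀ α₀ : HypArr.Form K ℓ, HypArr.InGeneralPosition α (k + 1) α₀ →
      ∃ W T : Submodule K (Fin n → K),
        (W : Set (Fin n → K)) = HypArr.weakPReps α α₀ (k + 1) ∧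
        (T : Set (Fin n → K)) = HypArr.trivialWeakPReps α α₀ ∧
        T ≤ W ∧
        Nonempty
          (HypArr.quotientDegreePart (HypArr.jacobianSaturation α k)
              (HypArr.jacobianIdeal α) (n - 1) ≃ₗ[K] (W ⧸ T.submoduleOf W)) := by
  have hn : n ≠ 0 := by
    rintro rfl
    have : HypArr.rank α = 0 := by
      simp [HypArr.rank, HypArr.rankOn, Set.eq_empty_of_isEmpty]
    omega
  refine ⟨HypArr.exists_inGeneralPosition α (k + 1), fun α₀ h0 =>
    ⟨HypArr.locallyEvalForms α k, LinearMap.range (HypArr.evalForms α),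
      HypArr.coe_locallyEvalForms_eq_weakPReps hα hk hkr h0,
      HypArr.coe_range_evalForms_eq_trivialWeakPReps hα (by omega) (h0.mono (by omega)),
      HypArr.range_evalForms_le α k, ⟨?_⟩⟩⟩
  rw [← HypArr.ker_toQuotient hα hn]
  exact ((HypArr.toQuotient α hn k).quotKerEquivOfSurjective
    (HypArr.toQuotient_surjective hα hn hk)).symm
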